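/- For a bounded operator $a$ on the Hilbert space $\mathbb{C}^2$ let $\|a\|$ be its operator norm and $\|a\|_2=(\operatorname{trace}(a^*a))^{1/2}$ its Hilbert–Schmidt norm. For $a,b\in\mathcal{B}(\mathbb{C}^2)$ let $T_{a,b}\colon\mathcal{B}(\mathbb{C}^2)\to\mathcal{B}(\mathbb{C}^2)$ be given by $T_{a,b}(x)=axb+bxa$, and let $\|T_{a,b}\|=\sup\{\|axb+bxa\| : \|x\|\le 1\}$. Suppose that $a,b\in\mathcal{B}(\mathbb{C}^2)$ are commuting normal operators and that $\|a\|_2/\|a\|\ge\|b\|_2/\|b\|$ (where $0/0$ is read as $0$). If there is a unit vector $\xi\in\mathbb{C}^2$ with $\|a\xi\|=\|a\|$ and $\|b\xi\|=\|b\|$, then $\|T_{a,b}\|=2\|a\|\|b\|$. If there is no such vector, then $$\|T_{a,b}\|=\begin{cases}2\|b\|\sqrt{\|a\|_2^2-\|a\|^2} & \text{if } \|a\|_2\ge\sqrt{3/2}\,\|a\| \text{ and } \|b\|_2^2<3\|b\|^2-\dfrac{\|a\|^2\|b\|^2}{\|a\|_2^2-\|a\|^2},\\[2ex] \dfrac{\|a\|_2^2\|b\|^2+\|a\|^2\|b\|_2^2-\|a\|_2^2\|b\|_2^2}{\sqrt{(2\|a\|^2-\|a\|_2^2)(2\|b\|^2-\|b\|_2^2)}}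 & \text{otherwise.}\end{cases}$$ -/

import Mathlib

/-- The algebra `B(ℂ²)` of bounded linear operators on the two-dimensional Hilbert space `ℂ²`;
its norm `‖a‖` is the operator norm. -/
abbrev BC2 : Type := EuclideanSpace ℂ (Fin 2) →L[ℂ] EuclideanSpace ℂ (Fin 2)

/-- The Hilbert–Schmidt norm `‖a‖₂ = (trace (a* a))^{1/2}`. -/
noncomputable def hsNorm (a : BC2) : ℝ :=
  Real.sqrt (LinearMap.trace ℂ (EuclideanSpace ℂ (Fin 2)) (star a * a : BC2).toLinearMap).re

/-- The elementary operator `T_{a,b} : x ↦ a x b + b x a` on `B(ℂ²)`, as a bounded linear map, so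
that its norm is the operator norm with respect to the operator norm on `B(ℂ²)`. -/
noncomputable def elemT (a b : BC2) : BC2 →L[ℂ] BC2 :=
  ContinuousLinearMap.mulLeftRight ℂ BC2 a b + ContinuousLinearMap.mulLeftRight ℂ BC2 b a

theorem elemT_apply (a b x : BC2) : elemT a b x = a * x * b + b * x * a := by
  simp [elemT]

/-- `a` and `b` attain their norms at a common unit vector. -/
def AttainNormsAtCommonUnitVector (a b : BC2) : Prop :=
  ∃ ξ : EuclideanSpace ℂ (Fin 2), ‖ξ‖ = 1 ∧ ‖a ξ‖ = ‖a‖ ∧ ‖b ξ‖ = ‖b‖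

open ComplexConjugate

local notation "E2" => EuclideanSpace ℂ (Fin 2)

/-! In a common orthonormal eigenbasis, `a` and `b` have eigenvalues `α i`, `β i`. If both norms are
attained at one index, the identity gives `2‖a‖‖b‖`. Otherwise `a` peaks at index 0 and `b` at index
1, after a possible swap.

For every `u > 0`, a weighted Cauchy–Schwarz inequality bounds the norm by the larger of `u|α i|² +
|β i|²/u` (`norm_elemT_le`). Minimising over `u` leaves two cases. Either the minimum `2|α 1||β 1|`
of the index-1 function dominates and `x = 1` attains it, or the optimal `u` makes both functions
equal to some `M`. Then `u aa* + bb*/u = M`, and a multiple of a unitary attains `M`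
(`le_norm_elemT`). -/

theorem star_sub_algebraMap (a : BC2) (μ : ℂ) :
    star (a - algebraMap ℂ BC2 μ) = star a - algebraMap ℂ BC2 (conj μ) := by
  rw [ContinuousLinearMap.star_eq_adjoint, map_sub, ← ContinuousLinearMap.star_eq_adjoint,
    ← ContinuousLinearMap.star_eq_adjoint, starRingEnd_apply, algebraMap_star_comm]

/-- With `a`, `a - μ` is also normal, so it has the same kernel as its adjoint. -/
theorem star_apply_of_apply_eq_smul {a : BC2} (ha : IsStarNormal a) {μ : ℂ} {v : E2}
    (hv : a v = μ • v) : (star a) v = conj μ • v := by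
  have hn : IsStarNormal (a - algebraMap ℂ BC2 μ) := by
    constructor
    have h1 := ha.star_comm_self
    rw [star_sub_algebraMap]
    exact ((h1.sub_right (Algebra.commute_algebraMap_right _ _)).sub_left
      (Algebra.commute_algebraMap_left _ _))
  have h := (ContinuousLinearMap.IsStarNormal.adjoint_apply_eq_zero_iff hn v).2 (by
    simp [hv, Algebra.algebraMap_eq_smul_one])
  rw [← ContinuousLinearMap.star_eq_adjoint, star_sub_algebraMap] at h
  simpa [sub_eq_zero, Algebra.algebraMap_eq_smul_one] using h

theorem exists_common_eigenvector {a b : BC2} (hab : Commute a b) :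
    ∃ v : E2, ‖v‖ = 1 ∧ ∃ μ ν : ℂ, a v = μ • v ∧ b v = ν • v := by
  obtain ⟨μ, hμ⟩ := Module.End.exists_eigenvalue (K := ℂ) (V := E2) a.toLinearMap
  have hab' : Commute a.toLinearMap b.toLinearMap := by
    ext1 v
    exact congrArg (fun f : BC2 => f v) hab.eq
  have hmap := Module.End.mapsTo_genEigenspace_of_comm hab' μ 1
  have : Nontrivial (Module.End.genEigenspace a.toLinearMap μ 1) :=
    (Submodule.nontrivial_iff_ne_bot).2 hμ
  obtain ⟨ν, hν⟩ := Module.End.exists_eigenvalue (K := ℂ) (b.toLinearMap.restrict hmap)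
  obtain ⟨w, hw⟩ := hν.exists_hasEigenvector
  have hbw : b w.1 = ν • w.1 := congrArg Subtype.val hw.apply_eq_smul
  have haw : a w.1 = μ • w.1 := Module.End.mem_eigenspace_iff.1 w.2
  have hw0 : w.1 ≠ 0 := fun h => hw.2 (Subtype.ext h)
  refine ⟨((‖w.1‖ : ℂ)⁻¹) • w.1, ?_, μ, ν, ?_, ?_⟩
  · rw [norm_smul, norm_inv, Complex.norm_real, norm_norm, inv_mul_cancel₀ (norm_ne_zero_iff.2 hw0)]
  · rw [map_smul, haw, smul_comm]
  · rw [map_smul, hbw, smul_comm]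

theorem apply_basis_one {a : BC2} (ha : IsStarNormal a) (e : OrthonormalBasis (Fin 2) ℂ E2) {μ : ℂ}
    (h : a (e 0) = μ • e 0) : a (e 1) = (inner ℂ (e 1) (a (e 1))) • e 1 := by
  have h0 : inner ℂ (e 0) (a (e 1)) = 0 := by
    rw [← ContinuousLinearMap.adjoint_inner_left, ← ContinuousLinearMap.star_eq_adjoint,
      star_apply_of_apply_eq_smul ha h, inner_smul_left, e.inner_eq_zero (by decide), mul_zero]
  conv_lhs => rw [← e.sum_repr' (a (e 1)), Fin.sum_univ_two, h0, zero_smul, zero_add]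

/-- Commuting normal operators on `ℂ²` are simultaneously unitarily diagonalizable. -/
theorem exists_common_eigenbasis {a b : BC2} (ha : IsStarNormal a) (hb : IsStarNormal b)
    (hab : Commute a b) : ∃ (e : OrthonormalBasis (Fin 2) ℂ E2) (α β : Fin 2 → ℂ),
      (∀ i, a (e i) = α i • e i) ∧ ∀ i, b (e i) = β i • e i := by
  obtain ⟨v, hv, μ, ν, hav, hbv⟩ := exists_common_eigenvector hab
  have ho : Orthonormal ℂ (Set.domRestrict {(0 : Fin 2)} (fun _ : Fin 2 => v)) := by
    refine ⟨fun _ => hv, fun i j hij => (hij ?_).elim⟩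
    exact Subsingleton.elim _ _
  obtain ⟨e, he⟩ := ho.exists_orthonormalBasis_extension_of_card_eq (by simp)
  have he0 : e 0 = v := he 0 rfl
  have ha0 : a (e 0) = μ • e 0 := by rw [he0, hav]
  have hb0 : b (e 0) = ν • e 0 := by rw [he0, hbv]
  refine ⟨e, ![μ, inner ℂ (e 1) (a (e 1))], ![ν, inner ℂ (e 1) (b (e 1))], ?_, ?_⟩
  · rw [Fin.forall_fin_two]
    exact ⟨ha0, apply_basis_one ha e ha0⟩
  · rw [Fin.forall_fin_two]
    exact ⟨hb0, apply_basis_one hb e hb0⟩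

/-! ### Norms and two-sided bounds in a common eigenbasis -/

section Diagonal

variable {a b : BC2} {e : OrthonormalBasis (Fin 2) ℂ (EuclideanSpace ℂ (Fin 2))} {α β : Fin 2 → ℂ}

theorem norm_sq_eq_sum_inner (e : OrthonormalBasis (Fin 2) ℂ E2) (v : E2) :
    ‖v‖ ^ 2 = ‖inner ℂ (e 0) v‖ ^ 2 + ‖inner ℂ (e 1) v‖ ^ 2 := by
  rw [← e.sum_sq_norm_inner_right, Fin.sum_univ_two]

theorem apply_eq_sum (ha : ∀ i, a (e i) = α i • e i) (v : E2) :
    a v = (inner ℂ (e 0) v * α 0) • e 0 + (inner ℂ (e 1) v * α 1) • e 1 := by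
  conv_lhs => rw [← e.sum_repr' v, Fin.sum_univ_two]
  simp [ha, smul_smul]

theorem norm_sq_comb (e : OrthonormalBasis (Fin 2) ℂ E2) (x y : ℂ) :
    ‖x • e 0 + y • e 1‖ ^ 2 = ‖x‖ ^ 2 + ‖y‖ ^ 2 := by
  rw [norm_sq_eq_sum_inner e]
  simp [e.inner_eq_ite]

theorem norm_sq_apply (ha : ∀ i, a (e i) = α i • e i) (v : E2) :
    ‖a v‖ ^ 2 = ‖α 0‖ ^ 2 * ‖inner ℂ (e 0) v‖ ^ 2 + ‖α 1‖ ^ 2 * ‖inner ℂ (e 1) v‖ ^ 2 := by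
  rw [apply_eq_sum ha, norm_sq_comb, norm_mul, norm_mul]
  ring

theorem norm_eigenvalue_le (ha : ∀ i, a (e i) = α i • e i) (i : Fin 2) : ‖α i‖ ≤ ‖a‖ := by
  simpa [ha, norm_smul] using a.le_opNorm (e i)

theorem norm_eq_max (ha : ∀ i, a (e i) = α i • e i) : ‖a‖ = max ‖α 0‖ ‖α 1‖ := by
  refine le_antisymm (a.opNorm_le_bound (by positivity) fun v => ?_)
    (max_le (norm_eigenvalue_le ha 0) (norm_eigenvalue_le ha 1))
  refine le_of_sq_le_sq ?_ (by positivity)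
  rw [mul_pow, norm_sq_apply ha, norm_sq_eq_sum_inner e, mul_add]
  gcongr
  · exact le_max_left _ _
  · exact le_max_right _ _

theorem hsNorm_sq (hn : IsStarNormal a) (ha : ∀ i, a (e i) = α i • e i) :
    hsNorm a ^ 2 = ‖α 0‖ ^ 2 + ‖α 1‖ ^ 2 := by
  have : (LinearMap.trace ℂ E2 (star a * a : BC2).toLinearMap).re = ‖α 0‖ ^ 2 + ‖α 1‖ ^ 2 := by
    rw [LinearMap.trace_eq_sum_inner _ e, Fin.sum_univ_two]
    simp [ha, star_apply_of_apply_eq_smul hn (ha _), inner_smul_right, ← Complex.normSq_eq_norm_sq,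
      Complex.normSq_apply]
  rw [hsNorm, this, Real.sq_sqrt (by positivity)]

theorem norm_star_apply (hn : IsStarNormal a) (v : E2) : ‖(star a) v‖ = ‖a v‖ :=
  ((ContinuousLinearMap.isStarNormal_iff_norm_eq_adjoint).1 hn v).symm

/-- Cauchy–Schwarz bound for the norm of `x ↦ a x b + b x a`. -/
theorem norm_elemT_le (hna : IsStarNormal a) (hnb : IsStarNormal b)
    (ha : ∀ i, a (e i) = α i • e i) (hb : ∀ i, b (e i) = β i • e i) {u M : ℝ} (hu : 0 < u)
    (h : ∀ i, u * ‖α i‖ ^ 2 + ‖β i‖ ^ 2 / u ≤ M) : ‖elemT a b‖ ≤ M := by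
  have hM : 0 ≤ M := le_trans (by positivity) (h 0)
  -- This is the operator inequality `u a*a + b*b/u ≤ M`, checked on the eigenbasis.
  have key (v : E2) : u * ‖a v‖ ^ 2 + ‖b v‖ ^ 2 / u ≤ M * ‖v‖ ^ 2 := by
    rw [norm_sq_apply ha, norm_sq_apply hb, norm_sq_eq_sum_inner e v]
    have h0 := mul_le_mul_of_nonneg_right (h 0) (sq_nonneg ‖inner ℂ (e 0) v‖)
    have h1 := mul_le_mul_of_nonneg_right (h 1) (sq_nonneg ‖inner ℂ (e 1) v‖)
    calc _ = (u * ‖α 0‖ ^ 2 + ‖β 0‖ ^ 2 / u) * ‖inner ℂ (e 0) v‖ ^ 2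
        + (u * ‖α 1‖ ^ 2 + ‖β 1‖ ^ 2 / u) * ‖inner ℂ (e 1) v‖ ^ 2 := by ring
      _ ≤ _ := by linarith
  refine ContinuousLinearMap.opNorm_le_bound _ hM fun x => ?_
  refine ContinuousLinearMap.opNorm_le_bound _ (by positivity) fun v => ?_
  set w := elemT a b x v with hw
  have h1 : ‖w‖ ^ 2 ≤ ‖x‖ * (‖a w‖ * ‖b v‖ + ‖b w‖ * ‖a v‖) := by
    have h2 : inner ℂ w w = inner ℂ ((star a) w) (x (b v)) + inner ℂ ((star b) w) (x (a v)) := by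
      rw [ContinuousLinearMap.star_eq_adjoint, ContinuousLinearMap.star_eq_adjoint,
        ContinuousLinearMap.adjoint_inner_left, ContinuousLinearMap.adjoint_inner_left,
        ← inner_add_right]
      conv_lhs => rw [hw, elemT_apply]
      rfl
    have h3 : ‖w‖ ^ 2 = ‖inner ℂ w w‖ := by
      rw [inner_self_eq_norm_sq_to_K]; simp
    rw [h3, h2]
    refine (norm_add_le _ _).trans ?_
    have h4 := norm_inner_le_norm (𝕜 := ℂ) ((star a) w) (x (b v))
    have h5 := norm_inner_le_norm (𝕜 := ℂ) ((star b) w) (x (a v))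
    rw [norm_star_apply hna] at h4
    rw [norm_star_apply hnb] at h5
    have h6 := mul_le_mul_of_nonneg_left (x.le_opNorm (b v)) (norm_nonneg (a w))
    have h7 := mul_le_mul_of_nonneg_left (x.le_opNorm (a v)) (norm_nonneg (b w))
    linarith
  have h2 : ‖a w‖ * ‖b v‖ + ‖b w‖ * ‖a v‖ ≤ M * ‖w‖ * ‖v‖ := by
    refine le_of_sq_le_sq ?_ (by positivity)
    calc _ ≤ (u * ‖a w‖ ^ 2 + ‖b w‖ ^ 2 / u) * (u * ‖a v‖ ^ 2 + ‖b v‖ ^ 2 / u) := by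
          -- Lagrange's identity: the Cauchy–Schwarz defect is a square.
          have : (u * ‖a w‖ ^ 2 + ‖b w‖ ^ 2 / u) * (u * ‖a v‖ ^ 2 + ‖b v‖ ^ 2 / u)
            - (‖a w‖ * ‖b v‖ + ‖b w‖ * ‖a v‖) ^ 2 = (u * ‖a w‖ * ‖a v‖ - ‖b w‖ * ‖b v‖ / u) ^ 2 := by
            field_simp
            ring
          nlinarith [sq_nonneg (u * ‖a w‖ * ‖a v‖ - ‖b w‖ * ‖b v‖ / u)]
      _ ≤ (M * ‖w‖ ^ 2) * (M * ‖v‖ ^ 2) := by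
          gcongr
          · exact key w
          · exact key v
      _ = _ := by ring
  rcases (norm_nonneg w).eq_or_lt with h0 | h0
  · rw [← h0]; positivity
  · have h3 := h1.trans (mul_le_mul_of_nonneg_left h2 (norm_nonneg x))
    refine le_of_mul_le_mul_left ?_ h0
    linarith

theorem two_mul_norm_mul_le (ha : ∀ i, a (e i) = α i • e i) (hb : ∀ i, b (e i) = β i • e i)
    (i : Fin 2) : 2 * ‖α i‖ * ‖β i‖ ≤ ‖elemT a b‖ := by
  have h1 := (elemT a b 1).le_opNorm (e i)
  have h2 := (elemT a b).le_opNorm 1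
  rw [norm_one, mul_one] at h2
  have h3 : elemT a b 1 (e i) = (2 * α i * β i) • e i := by
    simp only [elemT_apply, mul_one, add_apply, mul_apply_eq_comp,
      ha, hb, map_smul, smul_smul, ← add_smul]
    congr 1; ring
  rw [h3, norm_smul, e.norm_eq_one, mul_one, mul_one, norm_mul, norm_mul] at h1
  simpa using h1.trans h2

/-- The operator with matrix `[[-conj w, r], [r, w]]` with respect to `e`. -/
noncomputable def reflectionLike (e : OrthonormalBasis (Fin 2) ℂ (EuclideanSpace ℂ (Fin 2)))
    (w : ℂ) (r : ℝ) : BC2 :=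
  LinearMap.toContinuousLinearMap
    (e.toBasis.constr ℂ ![(-conj w) • e 0 + (r : ℂ) • e 1, (r : ℂ) • e 0 + w • e 1])

theorem reflectionLike_apply (e : OrthonormalBasis (Fin 2) ℂ E2) (w : ℂ) (r : ℝ) (x y : ℂ) :
    reflectionLike e w r (x • e 0 + y • e 1) =
      (-conj w * x + r * y) • e 0 + (r * x + w * y) • e 1 := by
  have h0 : reflectionLike e w r (e 0) = (-conj w) • e 0 + (r : ℂ) • e 1 := by
    simp [reflectionLike]
  have h1 : reflectionLike e w r (e 1) = (r : ℂ) • e 0 + w • e 1 := by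
    simp [reflectionLike]
  rw [map_add, map_smul, map_smul, h0, h1]
  module

/-- The matrix `X` satisfies `X*X = |w|² + r²`, so it is a multiple of a unitary. -/
theorem norm_reflectionLike_le (e : OrthonormalBasis (Fin 2) ℂ E2) (w : ℂ) (r : ℝ) {D : ℝ}
    (hD : 0 ≤ D) (h : ‖w‖ ^ 2 + r ^ 2 = D ^ 2) : ‖reflectionLike e w r‖ ≤ D := by
  refine ContinuousLinearMap.opNorm_le_bound _ hD fun v => ?_
  refine le_of_sq_le_sq ?_ (by positivity)
  obtain ⟨x, y, rfl⟩ : ∃ x y : ℂ, v = x • e 0 + y • e 1 :=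
    ⟨_, _, by rw [← Fin.sum_univ_two (fun i => (inner ℂ (e i) v) • e i), e.sum_repr']⟩
  rw [reflectionLike_apply, mul_pow, norm_sq_comb, norm_sq_comb, ← h]
  simp only [← Complex.normSq_eq_norm_sq, Complex.normSq_apply]
  simp
  nlinarith

theorem apply_comb (ha : ∀ i, a (e i) = α i • e i) (x y : ℂ) :
    a (x • e 0 + y • e 1) = (α 0 * x) • e 0 + (α 1 * y) • e 1 := by
  rw [map_add, map_smul, map_smul, ha, ha, smul_smul, smul_smul, mul_comm x, mul_comm y]

/-- Equality in Cauchy–Schwarz requires `u‖aξ‖ = ‖bξ‖`, which fixes `ξ = (s, t)`. The choice of `w`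
gives `X b ξ = u d a*ξ` and `X a ξ = (d/u) b*ξ`, hence `T(X)ξ = d(u aa* + bb*/u)ξ = dMξ` with `‖X‖ ≤
|d|`. -/
theorem le_norm_elemT (ha : ∀ i, a (e i) = α i • e i) (hb : ∀ i, b (e i) = β i • e i) {u M : ℝ}
    (hu : 0 < u) (h : ∀ i, u * ‖α i‖ ^ 2 + ‖β i‖ ^ 2 / u = M)
    (h0 : 0 ≤ ‖β 1‖ ^ 2 / u - u * ‖α 1‖ ^ 2) (h1 : 0 < u * ‖α 0‖ ^ 2 - ‖β 0‖ ^ 2 / u)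
    (hd : α 0 * β 1 - α 1 * β 0 ≠ 0) : M ≤ ‖elemT a b‖ := by
  set s := Real.sqrt (‖β 1‖ ^ 2 / u - u * ‖α 1‖ ^ 2) with hs
  set t := Real.sqrt (u * ‖α 0‖ ^ 2 - ‖β 0‖ ^ 2 / u) with ht
  have hs2 : s ^ 2 = ‖β 1‖ ^ 2 / u - u * ‖α 1‖ ^ 2 := Real.sq_sqrt h0
  have ht2 : t ^ 2 = u * ‖α 0‖ ^ 2 - ‖β 0‖ ^ 2 / u := Real.sq_sqrt h1.le
  set d := α 0 * β 1 - α 1 * β 0 with hd_def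
  have hM : 0 ≤ M := by rw [← h 0]; positivity
  have hdn : 0 < ‖d‖ := norm_pos_iff.2 hd
  have huC : (u : ℂ) ≠ 0 := by exact_mod_cast hu.ne'
  have hC (z : ℂ) : ((‖z‖ ^ 2 : ℝ) : ℂ) = z * conj z := by
    rw [← Complex.normSq_eq_norm_sq, Complex.mul_conj]
  set w : ℂ := u * α 0 * conj (α 1) - β 0 * conj (β 1) / u with hw
  set X := reflectionLike e w (s * t) with hX
  have hXn : ‖X‖ ≤ ‖d‖ := by
    refine norm_reflectionLike_le e w _ hdn.le ?_
    rw [mul_pow, hs2, ht2]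
    apply Complex.ofReal_injective
    rw [Complex.ofReal_add, Complex.ofReal_mul, Complex.ofReal_sub, Complex.ofReal_sub,
      Complex.ofReal_div, Complex.ofReal_div, Complex.ofReal_mul, Complex.ofReal_mul,
      hC, hC, hC, hC, hC, hC, hw, hd_def]
    simp
    field_simp
    ring
  set ξ : E2 := (s : ℂ) • e 0 + (t : ℂ) • e 1 with hξ
  have hξ0 : 0 < ‖ξ‖ := by
    refine norm_pos_iff.2 fun h2 => ?_
    have h3 := norm_sq_comb e (s : ℂ) (t : ℂ)
    rw [← hξ, h2, norm_zero, Complex.norm_real, Complex.norm_real, Real.norm_eq_abs,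
      Real.norm_eq_abs, sq_abs, sq_abs, ht2] at h3
    nlinarith [sq_nonneg s]
  have hs2C : (s : ℂ) ^ 2 = β 1 * conj (β 1) / u - u * (α 1 * conj (α 1)) := by
    rw [← hC, ← hC]; exact_mod_cast hs2
  have ht2C : (t : ℂ) ^ 2 = u * (α 0 * conj (α 0)) - β 0 * conj (β 0) / u := by
    rw [← hC, ← hC]; exact_mod_cast ht2
  have hM0 : u * (α 0 * conj (α 0)) + β 0 * conj (β 0) / u = M := by
    rw [← hC, ← hC]; exact_mod_cast h 0
  have hM1 : u * (α 1 * conj (α 1)) + β 1 * conj (β 1) / u = M := by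
    rw [← hC, ← hC]; exact_mod_cast h 1
  have hT : elemT a b X ξ = (d * M) • ξ := by
    simp only [elemT_apply, add_apply, mul_apply_eq_comp, hξ,
      apply_comb ha, apply_comb hb, hX, reflectionLike_apply]
    rw [smul_add, smul_smul, smul_smul, add_add_add_comm, ← add_smul, ← add_smul]
    congr 2
    · rw [← hM0, hw, hd_def]
      simp
      linear_combination (norm := skip) (s * (α 0 * β 1 + β 0 * α 1)) * ht2C
      field_simp
      ring
    · rw [← hM1, hw, hd_def]
      simp
      linear_combination (norm := skip) (t * (α 1 * β 0 + β 1 * α 0)) * hs2C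
      field_simp
      ring
  have h2 := (elemT a b X).le_opNorm ξ
  have h3 := (elemT a b).le_opNorm X
  rw [hT, norm_smul, norm_mul, Complex.norm_real, Real.norm_of_nonneg hM] at h2
  have h4 := le_of_mul_le_mul_right h2 hξ0
  have h5 := mul_le_mul_of_nonneg_left hXn (norm_nonneg (elemT a b))
  refine le_of_mul_le_mul_left ?_ hdn
  linarith

end Diagonal

/-! ### Attainment of the norms and the case formula -/

theorem norm_elemT_of_attain {a b : BC2} {e : OrthonormalBasis (Fin 2) ℂ E2} {α β : Fin 2 → ℂ}
    (ha : ∀ i, a (e i) = α i • e i) (hb : ∀ i, b (e i) = β i • e i) {i : Fin 2}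
    (hαi : ‖α i‖ = ‖a‖) (hβi : ‖β i‖ = ‖b‖) : ‖elemT a b‖ = 2 * ‖a‖ * ‖b‖ := by
  refine le_antisymm (ContinuousLinearMap.opNorm_le_bound _ (by positivity) fun x => ?_) ?_
  · rw [elemT_apply]
    refine (norm_add_le _ _).trans ?_
    have h1 := norm_mul₃_le (a := a) (b := x) (c := b)
    have h2 := norm_mul₃_le (a := b) (b := x) (c := a)
    linarith
  · simpa [hαi, hβi] using two_mul_norm_mul_le ha hb i

theorem exists_index_of_attain {a b : BC2} {e : OrthonormalBasis (Fin 2) ℂ E2} {α β : Fin 2 → ℂ}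
    (ha : ∀ i, a (e i) = α i • e i) (hb : ∀ i, b (e i) = β i • e i)
    (h : AttainNormsAtCommonUnitVector a b) : ∃ i, ‖α i‖ = ‖a‖ ∧ ‖β i‖ = ‖b‖ := by
  obtain ⟨ξ, hξ, haξ, hbξ⟩ := h
  -- `‖cξ‖²` is a convex combination of the `|γ i|²`, so every index in the support of `ξ` is
  -- maximal; one such index serves both operators.
  have key {c : BC2} {γ : Fin 2 → ℂ} (hc : ∀ i, c (e i) = γ i • e i) (hcξ : ‖c ξ‖ = ‖c‖)
      (i : Fin 2) (hi : inner ℂ (e i) ξ ≠ 0) : ‖γ i‖ = ‖c‖ := by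
    refine (norm_eigenvalue_le hc i).antisymm ?_
    by_contra! hlt
    have h1 := norm_sq_apply hc ξ
    have h2 := norm_sq_eq_sum_inner e ξ
    have hlt2 : ‖γ i‖ ^ 2 < ‖c‖ ^ 2 := by gcongr
    have hle (j : Fin 2) : ‖γ j‖ ^ 2 ≤ ‖c‖ ^ 2 := by
      gcongr
      exact norm_eigenvalue_le hc j
    have hi' : 0 < ‖inner ℂ (e i) ξ‖ ^ 2 := by positivity
    rw [hcξ] at h1
    rw [hξ] at h2
    have hz := mul_pos (sub_pos.2 hlt2) hi'
    have h30 := mul_nonneg (sub_nonneg.2 (hle 0)) (sq_nonneg ‖inner ℂ (e 0) ξ‖)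
    have h31 := mul_nonneg (sub_nonneg.2 (hle 1)) (sq_nonneg ‖inner ℂ (e 1) ξ‖)
    have h4 : ‖c‖ ^ 2 * (‖inner ℂ (e 0) ξ‖ ^ 2 + ‖inner ℂ (e 1) ξ‖ ^ 2) = ‖c‖ ^ 2 := by
      rw [← h2]; ring
    fin_cases i <;> simp at hz <;> linarith
  have : ∃ i, inner ℂ (e i) ξ ≠ 0 := by
    by_contra! h0
    have := norm_sq_eq_sum_inner e ξ
    rw [h0, h0, hξ] at this
    norm_num at this
  obtain ⟨i, hi⟩ := this
  exact ⟨i, key ha haξ i hi, key hb hbξ i hi⟩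

theorem attain_of_index {a b : BC2} {e : OrthonormalBasis (Fin 2) ℂ E2} {α β : Fin 2 → ℂ}
    (ha : ∀ i, a (e i) = α i • e i) (hb : ∀ i, b (e i) = β i • e i) {i : Fin 2}
    (hαi : ‖α i‖ = ‖a‖) (hβi : ‖β i‖ = ‖b‖) : AttainNormsAtCommonUnitVector a b :=
  ⟨e i, by simp, by simp [ha, norm_smul, hαi], by simp [hb, norm_smul, hβi]⟩

/-- The norm formula when the eigenvalues of largest modulus of the two operators belong to
different eigenvectors. -/
theorem norm_elemT_of_lt {a b : BC2} {e : OrthonormalBasis (Fin 2) ℂ E2} {α β : Fin 2 → ℂ}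
    (hna : IsStarNormal a) (hnb : IsStarNormal b)
    (ha : ∀ i, a (e i) = α i • e i) (hb : ∀ i, b (e i) = β i • e i)
    (hα : ‖α 1‖ < ‖α 0‖) (hβ : ‖β 0‖ < ‖β 1‖) (hratio : ‖α 0‖ * ‖β 0‖ ≤ ‖α 1‖ * ‖β 1‖) :
    ‖elemT a b‖ =
        if hsNorm a ≥ Real.sqrt (3 / 2) * ‖a‖ ∧
            hsNorm b ^ 2 < 3 * ‖b‖ ^ 2 - (‖a‖ ^ 2 * ‖b‖ ^ 2) / (hsNorm a ^ 2 - ‖a‖ ^ 2) then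
          2 * ‖b‖ * Real.sqrt (hsNorm a ^ 2 - ‖a‖ ^ 2)
        else
          (hsNorm a ^ 2 * ‖b‖ ^ 2 + ‖a‖ ^ 2 * hsNorm b ^ 2 - hsNorm a ^ 2 * hsNorm b ^ 2) /
            Real.sqrt ((2 * ‖a‖ ^ 2 - hsNorm a ^ 2) * (2 * ‖b‖ ^ 2 - hsNorm b ^ 2)) := by
  have hna' : ‖a‖ = ‖α 0‖ := by rw [norm_eq_max ha, max_eq_left hα.le]
  have hnb' : ‖b‖ = ‖β 1‖ := by rw [norm_eq_max hb, max_eq_right hβ.le]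
  have hcond : hsNorm a ≥ Real.sqrt (3 / 2) * ‖a‖ ↔ ‖α 0‖ ^ 2 ≤ 2 * ‖α 1‖ ^ 2 := by
    have h1 : (Real.sqrt (3 / 2) * ‖a‖) ^ 2 = 3 / 2 * ‖α 0‖ ^ 2 := by
      rw [mul_pow, Real.sq_sqrt (by norm_num), hna']
    have h0 : 0 ≤ hsNorm a := Real.sqrt_nonneg _
    rw [ge_iff_le, ← pow_le_pow_iff_left₀ (by positivity) h0 two_ne_zero, h1, hsNorm_sq hna ha]
    constructor <;> intro h <;> linarith
  simp only [hcond]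
  rw [hsNorm_sq hna ha, hsNorm_sq hnb hb, hna', hnb', add_sub_cancel_left,
    Real.sqrt_sq (norm_nonneg _)]
  have hA : 0 < ‖α 0‖ := (norm_nonneg _).trans_lt hα
  have hB : 0 < ‖β 1‖ := (norm_nonneg _).trans_lt hβ
  have hd : α 0 * β 1 - α 1 * β 0 ≠ 0 := by
    intro h
    have h1 : ‖α 0‖ * ‖β 1‖ = ‖α 1‖ * ‖β 0‖ := by
      rw [← norm_mul, ← norm_mul, sub_eq_zero.1 h]
    have h2 : ‖α 1‖ * ‖β 0‖ < ‖α 0‖ * ‖β 1‖ :=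
      mul_lt_mul'' hα hβ (norm_nonneg _) (norm_nonneg _)
    linarith
  have hα0 := norm_nonneg (α 1)
  have hβ0 := norm_nonneg (β 0)
  have hlow := two_mul_norm_mul_le ha hb 1
  have hup := fun (u M : ℝ) => norm_elemT_le (u := u) (M := M) hna hnb ha hb
  have hlow' := fun (u M : ℝ) hu h h0 h1 => le_norm_elemT (u := u) (M := M) ha hb hu h h0 h1 hd
  simp only [Fin.forall_fin_two] at hup hlow'
  generalize ‖α 0‖ = A at *
  generalize ‖α 1‖ = p at *
  generalize ‖β 0‖ = q at *
  generalize ‖β 1‖ = B at *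
  split_ifs with h
  · obtain ⟨h1, h2⟩ := h
    -- The first condition excludes `p = 0`, where the quotient in the second would be the default
    -- 0.
    have hp : 0 < p := by nlinarith
    -- `u = B / p` minimises `u p² + B²/u`, with value `2pB`.
    refine le_antisymm (hup (B / p) _ (by positivity) ⟨?_, ?_⟩) (by linarith)
    · have h3 : A ^ 2 * B ^ 2 < (2 * B ^ 2 - q ^ 2) * p ^ 2 := by
        rw [← div_lt_iff₀ (by positivity)]; linarith
      have h4 : B / p * A ^ 2 + q ^ 2 / (B / p) = (A ^ 2 * B ^ 2 + p ^ 2 * q ^ 2) / (B * p) := by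
        field_simp
      rw [h4, div_le_iff₀ (by positivity)]
      linarith
    · field_simp
      linarith
  · have h3 : 2 * p ^ 2 * B ^ 2 ≤ A ^ 2 * B ^ 2 + p ^ 2 * q ^ 2 := by
      by_cases h1 : A ^ 2 ≤ 2 * p ^ 2
      · have hp : 0 < p := by nlinarith
        have h2 := not_lt.1 fun h2 => h ⟨h1, h2⟩
        have h4 : 2 * B ^ 2 - q ^ 2 ≤ A ^ 2 * B ^ 2 / p ^ 2 := by linarith
        rw [le_div_iff₀ (by positivity)] at h4
        linarith
      · have := mul_le_mul_of_nonneg_right (not_le.1 h1).le (sq_nonneg B)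
        nlinarith [mul_nonneg (sq_nonneg p) (sq_nonneg q)]
    have hS : 0 < A ^ 2 - p ^ 2 := by nlinarith
    have hR : 0 < B ^ 2 - q ^ 2 := by nlinarith
    -- The difference is `(A² - p²)(B² - q²) + (p²B² - A²q²)`; the ratio hypothesis makes the last
    -- term nonnegative.
    have h4 : 2 * A ^ 2 * q ^ 2 < A ^ 2 * B ^ 2 + p ^ 2 * q ^ 2 := by
      have h5 : (A * q) ^ 2 ≤ (p * B) ^ 2 := by gcongr
      have h6 : 0 < (A ^ 2 - p ^ 2) * (B ^ 2 - q ^ 2) := mul_pos hS hR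
      have h7 : 0 ≤ A ^ 2 * q ^ 2 := by positivity
      nlinarith
    set s := Real.sqrt (A ^ 2 - p ^ 2) with hs
    set r := Real.sqrt (B ^ 2 - q ^ 2) with hr
    have hs0 : 0 < s := Real.sqrt_pos.2 hS
    have hr0 : 0 < r := Real.sqrt_pos.2 hR
    have hs2 : s ^ 2 = A ^ 2 - p ^ 2 := Real.sq_sqrt hS.le
    have hr2 : r ^ 2 = B ^ 2 - q ^ 2 := Real.sq_sqrt hR.le
    have hden : Real.sqrt ((2 * A ^ 2 - (A ^ 2 + p ^ 2)) * (2 * B ^ 2 - (q ^ 2 + B ^ 2)))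
        = s * r := by
      rw [hs, hr, ← Real.sqrt_mul hS.le]
      congr 1; ring
    rw [hden]
    have e0 : r / s * A ^ 2 + q ^ 2 / (r / s) = ((A ^ 2 + p ^ 2) * B ^ 2 + A ^ 2 * (q ^ 2 + B ^ 2)
        - (A ^ 2 + p ^ 2) * (q ^ 2 + B ^ 2)) / (s * r) := by
      field_simp
      rw [hs2, hr2]; ring
    have e1 : r / s * p ^ 2 + B ^ 2 / (r / s) = ((A ^ 2 + p ^ 2) * B ^ 2 + A ^ 2 * (q ^ 2 + B ^ 2)
        - (A ^ 2 + p ^ 2) * (q ^ 2 + B ^ 2)) / (s * r) := by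
      field_simp
      rw [hs2, hr2]; ring
    -- `u = r / s` solves `u A² + q²/u = u p² + B²/u`.
    refine le_antisymm (hup (r / s) _ (by positivity) ⟨e0.le, e1.le⟩)
      (hlow' (r / s) _ (by positivity) ⟨e0, e1⟩ ?_ ?_)
    · have : B ^ 2 / (r / s) - r / s * p ^ 2
          = (A ^ 2 * B ^ 2 + p ^ 2 * q ^ 2 - 2 * p ^ 2 * B ^ 2) / (s * r) := by
        field_simp
        rw [hs2, hr2]; ring
      rw [this]
      exact div_nonneg (by linarith) (by positivity)
    · have : r / s * A ^ 2 - q ^ 2 / (r / s)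
          = (A ^ 2 * B ^ 2 + p ^ 2 * q ^ 2 - 2 * A ^ 2 * q ^ 2) / (s * r) := by
        field_simp
        rw [hs2, hr2]; ring
      rw [this]
      exact div_pos (by linarith) (by positivity)

theorem mul_norm_le_of_ratio {A B p q : ℝ} (hA : 0 < A) (hB : 0 < B) (hp : 0 ≤ p) {x y : ℝ}
    (hy : 0 ≤ y) (hx2 : x ^ 2 = A ^ 2 + p ^ 2) (hy2 : y ^ 2 = B ^ 2 + q ^ 2)
    (h : y / B ≤ x / A) : A * q ≤ p * B := by
  refine le_of_sq_le_sq ?_ (by positivity)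
  have h1 : (y / B) ^ 2 ≤ (x / A) ^ 2 := by gcongr
  rw [div_pow, div_pow, hx2, hy2, div_le_div_iff₀ (by positivity) (by positivity)] at h1
  nlinarith

theorem proposition4p3 (a b : BC2) (ha : IsStarNormal a) (hb : IsStarNormal b)
    (hab : Commute a b) (hratio : hsNorm a / ‖a‖ ≥ hsNorm b / ‖b‖) :
    (AttainNormsAtCommonUnitVector a b → ‖elemT a b‖ = 2 * ‖a‖ * ‖b‖) ∧
    (¬ AttainNormsAtCommonUnitVector a b →
      ‖elemT a b‖ =
        if hsNorm a ≥ Real.sqrt (3 / 2) * ‖a‖ ∧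
            hsNorm b ^ 2 < 3 * ‖b‖ ^ 2 - (‖a‖ ^ 2 * ‖b‖ ^ 2) / (hsNorm a ^ 2 - ‖a‖ ^ 2) then
          2 * ‖b‖ * Real.sqrt (hsNorm a ^ 2 - ‖a‖ ^ 2)
        else
          (hsNorm a ^ 2 * ‖b‖ ^ 2 + ‖a‖ ^ 2 * hsNorm b ^ 2 - hsNorm a ^ 2 * hsNorm b ^ 2) /
            Real.sqrt ((2 * ‖a‖ ^ 2 - hsNorm a ^ 2) * (2 * ‖b‖ ^ 2 - hsNorm b ^ 2))) := by
  obtain ⟨e, α, β, hae, hbe⟩ := exists_common_eigenbasis ha hb hab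
  refine ⟨fun h => ?_, fun h => ?_⟩
  · obtain ⟨i, h1, h2⟩ := exists_index_of_attain hae hbe h
    exact norm_elemT_of_attain hae hbe h1 h2
  · have main {e : OrthonormalBasis (Fin 2) ℂ E2} {α β : Fin 2 → ℂ}
        (hae : ∀ i, a (e i) = α i • e i) (hbe : ∀ i, b (e i) = β i • e i)
        (h01 : ‖α 1‖ ≤ ‖α 0‖) : ‖α 1‖ < ‖α 0‖ ∧ ‖β 0‖ < ‖β 1‖ ∧
          ‖α 0‖ * ‖β 0‖ ≤ ‖α 1‖ * ‖β 1‖ := by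
      have hna : ‖a‖ = ‖α 0‖ := by rw [norm_eq_max hae, max_eq_left h01]
      have hβ : ‖β 0‖ < ‖β 1‖ := by
        by_contra! h1
        exact h (attain_of_index hae hbe (i := 0) hna.symm (by rw [norm_eq_max hbe, max_eq_left h1]))
      have hnb : ‖b‖ = ‖β 1‖ := by rw [norm_eq_max hbe, max_eq_right hβ.le]
      have hα : ‖α 1‖ < ‖α 0‖ := by
        by_contra! h1
        exact h (attain_of_index hae hbe (i := 1)
          ((h01.antisymm h1).trans hna.symm) hnb.symm)
      refine ⟨hα, hβ, mul_norm_le_of_ratio ((norm_nonneg _).trans_lt hα)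
        ((norm_nonneg _).trans_lt hβ) (norm_nonneg _) (Real.sqrt_nonneg _)
        (hsNorm_sq ha hae) ((hsNorm_sq hb hbe).trans (add_comm _ _)) ?_⟩
      rw [← hna, ← hnb]
      exact hratio
    rcases le_total ‖α 1‖ ‖α 0‖ with h01 | h01
    · obtain ⟨h1, h2, h3⟩ := main hae hbe h01
      exact norm_elemT_of_lt ha hb hae hbe h1 h2 h3
    -- Swapping the basis vectors puts the peak of `a` at index 0.
    · set e' := e.reindex (Equiv.swap 0 1)
      have hae' (i) : a (e' i) = (α ∘ Equiv.swap 0 1) i • e' i := by simp [e', hae]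
      have hbe' (i) : b (e' i) = (β ∘ Equiv.swap 0 1) i • e' i := by simp [e', hbe]
      obtain ⟨h1, h2, h3⟩ := main hae' hbe' (by simpa using h01)
      exact norm_elemT_of_lt ha hb hae' hbe' h1 h2 h3
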